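/- Let $N\ge 2$, let $X_1,\dots,X_N$ be compact subsets of $\mathbb{R}^n$ with Borel probability measures $\mu_1,\dots,\mu_N$, and let $c:X_1\times\cdots\times X_N\to\mathbb{R}$ be continuous. For $i=2,\dots,N$ let $P_i=\{X_{i,k}\}_{k=1}^{K_i}$ be a Borel ordered partition of $X_i$, that is, a finite ordered list of pairwise disjoint Borel sets with union $X_i$. The Kantorovich problem is to minimize $\int c\,d\lambda$ over the set $\Pi(\mu_1,\dots,\mu_N)$ of probability measures on $X_1\times\cdots\times X_N$ with marginals $\mu_1,\dots,\mu_N$; a minimizer is called an optimal plan. Its dual is to maximize $\sum_{i}\int\varphi_i\,d\mu_i$ over all $\varphi_i\in L^1(X_i,\mu_i)$ with $\sum_{i}\varphi_i(x_i)\le c(x_1,\dots,x_N)$ for all $(x_1,\dots,x_N)$. Let $\varphi_1,\dots,\varphi_N$ be continuous functions that solve the dual problem, and let $$\mathcal S=\Big\{x\in\prod_{i=1}^N X_i:\ c(x)=\sum_{i=1}^N\varphi_i(x_i)\Big\}$$ be the corresponding minimizing set. For $2\le j\le N$ let $\pi_j(x_1,\dots,x_N)=(x_1,\dots,x_j)$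 and $$c_j(x_1,\dots,x_j)=\inf\Big\{c(x_1,\dots,x_N)-\sum_{i=j+1}^N\varphi_i(x_i):\ (x_{j+1},\dots,x_N)\in\prod_{i=j+1}^N X_i\Big\},$$ so that $c_N=c$ and $\pi_N(\mathcal S)=\mathcal S$. Let $W$ and $Y$ be spaces with probability measures $\rho$ and $\nu$, let $b:W\times Y\to\mathbb{R}$, $S\subseteq W\times Y$, and let $P=\{Y_k\}_{k=1}^K$ be a Borel ordered partition of $Y$. Put $F(w)=\{y:(w,y)\in S\}$; if $F(w)\neq\emptyset$, let $\kappa(w)=\min\{k: F(w)\cap Y_k\ne\emptyset\}$ and let $f_P(w)$ be the (possibly empty) set of maximizers of $b(w,\cdot)$ on $F(w)\cap Y_{\kappa(w)}$; if $F(w)=\emptyset$, put $f_P(w)=\emptyset$. Write $\mathrm{Dom}$ for the set of points where a set-valued map is non-empty. The set $S$ is called $(b,P)$-extreme with respect to $(\rho,\nu)$ if there are sets $M\subseteq W$ and $T\subseteq Y$ of full $\rho$- and $\nu$-measure, respectively, such that 1. $\mathrm{Dom}(F)\cap M=\mathrm{Dom}(f_P)\cap M$; 2. for all distinct $w_1,w_2\in\mathrm{Dom}(F)\cap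 M$ and all $y_1\in f_P(w_1)$, $y_2\in f_P(w_2)$, $$(F(w_1)\setminus\{y_1\})\cap(F(w_2)\setminus\{y_2\})\cap T=\emptyset .$$ Suppose that for every optimal plan $\lambda$ the set $\mathcal S$ is $(c,P_N)$-extreme and, for $j=2,\dots,N-1$, the set $\pi_j(\mathcal S)$ is $(c_j,P_j)$-extreme, where $\pi_j(\mathcal S)$ (for $2\le j\le N$) is regarded as a subset of $W\times X_j$ with $W=\prod_{i<j}X_i$, and extremality is with respect to the measures $\lambda_{j-1}$ on $W$ (the image of $\lambda$ under $(x_1,\dots,x_N)\mapsto(x_1,\dots,x_{j-1})$) and $\mu_j$ on $X_j$. Then the $N$-marginal Kantorovich problem has exactly one optimal plan. -/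

import Mathlib

open MeasureTheory

/-! ### Extreme sets for a pair of spaces -/

section TwoMarginal

variable {W Y : Type*}

/-- A Borel ordered partition `{Y_k}_{k=1}^K` of `Y`: finitely many pairwise disjoint measurable
sets, listed in a fixed order, whose union is `Y`. -/
def IsOrderedPartition [MeasurableSpace Y] {K : ℕ} (P : Fin K → Set Y) : Prop :=
  (∀ k, MeasurableSet (P k)) ∧ Pairwise (fun k l => Disjoint (P k) (P l)) ∧ ⋃ k, P k = Set.univ

/-- The set-valued map `F(w) = {y | (w, y) ∈ S}`. -/
def fiberMap (S : Set (W × Y)) (w : W) : Set Y := {y | (w, y) ∈ S}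

/-- The set-valued map `f_P(w) = argmax {c(w, y) | y ∈ F(w) ∩ Y_κ(w)}`, where `κ(w)` is the least
index `k` such that `F(w)` meets `Y_k`. It is empty if `F(w)` is empty or if the maximum is not
attained. -/
def argmaxMap {K : ℕ} (c : W × Y → ℝ) (P : Fin K → Set Y) (S : Set (W × Y)) (w : W) : Set Y :=
  {y | ∃ κ, IsLeast {k | (fiberMap S w ∩ P k).Nonempty} κ ∧
    y ∈ fiberMap S w ∩ P κ ∧ ∀ y' ∈ fiberMap S w ∩ P κ, c (w, y') ≤ c (w, y)}

/-- The domain of a set-valued map. -/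
def setDom (F : W → Set Y) : Set W := {w | (F w).Nonempty}

/-- `S ⊆ W × Y` is `(c, P)`-extreme with respect to the marginals `ρ` on `W` and `ν` on `Y`.
A set has full measure when its complement is null. -/
def IsExtremeSet [MeasurableSpace W] [MeasurableSpace Y] {K : ℕ} (c : W × Y → ℝ)
    (P : Fin K → Set Y) (S : Set (W × Y)) (ρ : Measure W) (ν : Measure Y) : Prop :=
  ∃ (M : Set W) (T : Set Y), ρ Mᶜ = 0 ∧ ν Tᶜ = 0 ∧
    setDom (fiberMap S) ∩ M = setDom (argmaxMap c P S) ∩ M ∧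
    ∀ w₁ ∈ setDom (fiberMap S) ∩ M, ∀ w₂ ∈ setDom (fiberMap S) ∩ M, w₁ ≠ w₂ →
      ∀ y₁ ∈ argmaxMap c P S w₁, ∀ y₂ ∈ argmaxMap c P S w₂,
        (fiberMap S w₁ \ {y₁}) ∩ (fiberMap S w₂ \ {y₂}) ∩ T = ∅

end TwoMarginal

/-! ### The multi-marginal problem -/

section MultiMarginal

variable {N : ℕ} {E : Fin N → Type*}

/-- `Π(μ_1, …, μ_N)`: the probability measures on the product with marginals `μ_i`. -/
def IsPlan [∀ i, MeasurableSpace (E i)] (μ : ∀ i, Measure (E i))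
    (lam : Measure (∀ i, E i)) : Prop :=
  IsProbabilityMeasure lam ∧ ∀ i, lam.map (fun x => x i) = μ i

/-- An optimal plan: a minimizer of `∫ c dλ` over `Π(μ_1, …, μ_N)`. -/
def IsOptimalPlan [∀ i, MeasurableSpace (E i)] (c : (∀ i, E i) → ℝ) (μ : ∀ i, Measure (E i))
    (lam : Measure (∀ i, E i)) : Prop :=
  IsPlan μ lam ∧ ∀ lam', IsPlan μ lam' → ∫ x, c x ∂lam ≤ ∫ x, c x ∂lam'

/-- The competitors in the dual problem: integrable `φ_i` with `∑ φ_i(x_i) ≤ c(x)` everywhere. -/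
def IsDualAdmissible [∀ i, MeasurableSpace (E i)] (c : (∀ i, E i) → ℝ) (μ : ∀ i, Measure (E i))
    (φ : ∀ i, E i → ℝ) : Prop :=
  (∀ i, Integrable (φ i) (μ i)) ∧ ∀ x, ∑ i, φ i (x i) ≤ c x

/-- Continuous potentials: continuous functions that attain the supremum of `∑ ∫ φ_i dμ_i` over
all the competitors in the dual problem. -/
def AreContinuousPotentials [∀ i, MeasurableSpace (E i)] [∀ i, TopologicalSpace (E i)]
    (c : (∀ i, E i) → ℝ) (μ : ∀ i, Measure (E i)) (φ : ∀ i, E i → ℝ) : Prop :=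
  (∀ i, Continuous (φ i)) ∧ IsDualAdmissible c μ φ ∧
    ∀ ψ, IsDualAdmissible c μ ψ → ∑ i, ∫ x, ψ i x ∂(μ i) ≤ ∑ i, ∫ x, φ i x ∂(μ i)

/-- The minimizing set given by potentials `φ`. -/
def minimizingSet (c : (∀ i, E i) → ℝ) (φ : ∀ i, E i → ℝ) : Set (∀ i, E i) :=
  {x | c x = ∑ i, φ i (x i)}

/-- The projection of the product onto the coordinates before `j`. -/
def projLT (j : Fin N) (x : ∀ i, E i) : (i : Set.Iio j) → E i := fun i => x i

/-- The projection `π_j` onto the coordinates up to and including `j`, where the product of these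
coordinate spaces is written as (product of the spaces before `j`) × (space `j`). -/
def projLE (j : Fin N) (x : ∀ i, E i) : ((i : Set.Iio j) → E i) × E j := (projLT j x, x j)

/-- The reduced cost `c_j(z) = inf {c(x) - ∑_{i > j} φ_i(x_i) | π_j(x) = z}`. For the last index
it is `c` itself, see `reducedCost_last`. -/
noncomputable def reducedCost (c : (∀ i, E i) → ℝ) (φ : ∀ i, E i → ℝ) (j : Fin N)
    (z : ((i : Set.Iio j) → E i) × E j) : ℝ :=
  sInf ((fun x : ∀ i, E i => c x - ∑ i ∈ Finset.Ioi j, φ i (x i)) '' (projLE j ⁻¹' {z}))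

lemma projLE_last_injective (j : Fin N) (hj : ∀ i, i ≤ j) :
    Function.Injective (projLE (E := E) j) := by
  intro x y h
  funext i
  rcases (hj i).lt_or_eq with hi | rfl
  · exact congrFun (congrArg Prod.fst h) ⟨i, hi⟩
  · exact congrArg Prod.snd h

/-- For the last index the reduced cost is the cost itself, and `projLE` is injective, so that the
image of the minimizing set is that set, seen in (product of the first `N - 1` spaces) × (last
space). -/
lemma reducedCost_last (c : (∀ i, E i) → ℝ) (φ : ∀ i, E i → ℝ) (j : Fin N) (hj : ∀ i, i ≤ j)
    (x : ∀ i, E i) : reducedCost c φ j (projLE j x) = c x := by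
  have h1 : projLE j ⁻¹' {projLE j x} = {x} := by
    ext y
    simpa using (projLE_last_injective j hj).eq_iff
  have h2 : Finset.Ioi j = ∅ := by
    ext i
    simpa using hj i
  simp [reducedCost, h1, h2]

end MultiMarginal

/-! Existence is Kantorovich duality: some plan has cost at most the dual value, hence is optimal.
Equality of the two values then forces `c = ∑ φ_i` almost everywhere for every optimal plan, so all
of them live on the minimizing set.

Uniqueness goes one coordinate at a time. If two optimal plans agree on the coordinates before `j`,
their images under `projLE j` have the same two marginals and live on the projected minimizing set.
There the reduced cost splits as `Φ(w) + φ_j(y)`, so over a fixed `w` maximizing it means maximizing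
`φ_j`. Hence `f_P(w)` consists of the lowest points of the fiber for a height of `y` alone
(`lexHeight`), and extremality forbids a path `y₁ - w₁ - y - w₂ - y₂` in which `y` is a weak local
maximum of the height.

Such a set carries at most one measure with given marginals (`measure_eq_of_no_local_max`). The
singular parts of the difference of two such measures would glue to a random alternating path whose
two halves have the same law. Without local maxima, a bounded function of a half (`chainHeight`)
increases strictly from one half to the next, although its mean cannot change. -/

/-! ### Gluing, alternating paths and measures on sets without local maxima -/

open ProbabilityTheory in
/-- The gluing lemma: two finite measures with the same first marginal are marginals of a
common measure. -/
lemma exists_glue {Z U V : Type*} [MeasurableSpace Z] [MeasurableSpace U] [MeasurableSpace V]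
    [StandardBorelSpace U] [Nonempty U] [StandardBorelSpace V] [Nonempty V]
    (A : Measure (Z × U)) (B : Measure (Z × V)) [IsFiniteMeasure A] [IsFiniteMeasure B]
    (h : A.fst = B.fst) :
    ∃ C : Measure (Z × (U × V)), IsFiniteMeasure C ∧
      C.map (fun p => (p.1, p.2.1)) = A ∧ C.map (fun p => (p.1, p.2.2)) = B := by
  -- The two remaining coordinates are taken conditionally independent given the shared one.
  refine ⟨A.fst ⊗ₘ (A.condKernel ×ₖ B.condKernel), inferInstance, ?_, ?_⟩
  · have := Measure.compProd_map (μ := A.fst) (κ := A.condKernel ×ₖ B.condKernel)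
      (f := Prod.fst) measurable_fst
    rw [← Kernel.fst_eq, Kernel.fst_prod, A.disintegrate A.condKernel] at this
    exact this.symm
  · have := Measure.compProd_map (μ := A.fst) (κ := A.condKernel ×ₖ B.condKernel)
      (f := Prod.snd) measurable_snd
    rw [← Kernel.snd_eq, Kernel.snd_prod, h, B.disintegrate B.condKernel, ← h] at this
    exact this.symm

/-- The mutually singular parts of the difference of two finite measures. -/
lemma exists_singular_parts {Z : Type*} [MeasurableSpace Z] (l₁ l₂ : Measure Z)
    [IsFiniteMeasure l₁] [IsFiniteMeasure l₂] :
    ∃ (a b : Measure Z) (s : Set Z), a ≤ l₁ ∧ b ≤ l₂ ∧ a sᶜ = 0 ∧ b s = 0 ∧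
      l₁ + b = l₂ + a := by
  obtain ⟨s, hs, h1, h2⟩ := hahn_decomposition l₁ l₂
  have e1 : l₂.restrict s ≤ l₁.restrict s := by
    refine Measure.le_iff.2 fun t ht => ?_
    rw [Measure.restrict_apply ht, Measure.restrict_apply ht]
    exact h1 _ (ht.inter hs) Set.inter_subset_right
  have e2 : l₁.restrict sᶜ ≤ l₂.restrict sᶜ := by
    refine Measure.le_iff.2 fun t ht => ?_
    rw [Measure.restrict_apply ht, Measure.restrict_apply ht]
    exact h2 _ (ht.inter hs.compl) Set.inter_subset_right
  refine ⟨l₁.restrict s - l₂.restrict s, l₂.restrict sᶜ - l₁.restrict sᶜ, s,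
    Measure.sub_le.trans Measure.restrict_le_self, Measure.sub_le.trans Measure.restrict_le_self,
    ?_, ?_, ?_⟩
  · refine le_antisymm ((Measure.sub_le (μ := l₁.restrict s) _).trans ?_) zero_le
    simp [Measure.restrict_apply hs.compl]
  · refine le_antisymm ((Measure.sub_le (μ := l₂.restrict sᶜ) _).trans ?_) zero_le
    simp [Measure.restrict_apply hs]
  · have f1 := Measure.sub_add_cancel_of_le e1
    have f2 := Measure.sub_add_cancel_of_le e2
    have g1 := Measure.restrict_add_restrict_compl (μ := l₁) hs
    have g2 := Measure.restrict_add_restrict_compl (μ := l₂) hs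
    generalize l₁.restrict s - l₂.restrict s = a at *
    generalize l₂.restrict sᶜ - l₁.restrict sᶜ = b at *
    calc l₁ + b = l₁.restrict s + (b + l₁.restrict sᶜ) := by
          conv_lhs => rw [← g1]
          abel
      _ = a + (l₂.restrict s + l₂.restrict sᶜ) := by rw [f2, ← f1]; abel
      _ = l₂ + a := by rw [g2, add_comm]

/-- A bounded function of two consecutive heights that increases strictly along every sequence
without weak local maxima. -/
noncomputable def chainHeight (a b : ℝ) : ℝ :=
  if a ≤ b then Real.pi + Real.arctan b else -Real.arctan b

lemma measurable_chainHeight : Measurable fun p : ℝ × ℝ => chainHeight p.1 p.2 :=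
  Measurable.ite (measurableSet_le measurable_fst measurable_snd)
    (measurable_const.add (Real.measurable_arctan.comp measurable_snd))
    (Real.measurable_arctan.comp measurable_snd).neg

lemma abs_chainHeight_le (a b : ℝ) : |chainHeight a b| ≤ 2 * Real.pi := by
  have h1 := Real.arctan_lt_pi_div_two b
  have h2 := Real.neg_pi_div_two_lt_arctan b
  unfold chainHeight
  split_ifs <;> rw [abs_le] <;> constructor <;> linarith [Real.pi_pos]

/-- Without a weak local maximum a sequence descends, then ascends forever. Descending steps get
values in `(-π/2, π/2)` that grow as the height falls; ascending steps get values in `(π/2, 3π/2)`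
that grow with the height. -/
lemma chainHeight_lt {a b c : ℝ} (h : b < a ∨ b < c) : chainHeight a b < chainHeight b c := by
  have h1 := Real.arctan_lt_pi_div_two b
  have h2 := Real.neg_pi_div_two_lt_arctan b
  have h3 := Real.arctan_lt_pi_div_two c
  have h4 := Real.neg_pi_div_two_lt_arctan c
  unfold chainHeight
  split_ifs with h5 h6 h6
  · have := Real.arctan_strictMono (h.resolve_left (not_lt.2 h5))
    linarith
  · exact absurd h (by push Not; exact ⟨h5, (not_le.1 h6).le⟩)
  · linarith
  · have := Real.arctan_strictMono (not_le.1 h6)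
    linarith

/-- Two finite measures with the same marginals coincide if they are concentrated on a set in
which no alternating path of length four has a weak local maximum of `h` in its middle. -/
theorem measure_eq_of_no_local_max {W Y : Type*} [MeasurableSpace W] [MeasurableSpace Y]
    [StandardBorelSpace W] [StandardBorelSpace Y]
    (S : Set (W × Y)) (h : Y → ℝ) (hh : Measurable h)
    (hS : ∀ w₁ w₂ y y₁ y₂, w₁ ≠ w₂ → y₁ ≠ y → y₂ ≠ y → (w₁, y) ∈ S → (w₁, y₁) ∈ S →
      (w₂, y) ∈ S → (w₂, y₂) ∈ S → h y₁ ≤ h y → h y₂ ≤ h y → False)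
    (l₁ l₂ : Measure (W × Y)) [IsFiniteMeasure l₁] [IsFiniteMeasure l₂]
    (hf : l₁.fst = l₂.fst) (hs : l₁.snd = l₂.snd)
    (h1 : ∀ᵐ p ∂l₁, p ∈ S) (h2 : ∀ᵐ p ∂l₂, p ∈ S) : l₁ = l₂ := by
  obtain ⟨a, b, s, ha, hb, has, hbs, hab⟩ := exists_singular_parts l₁ l₂
  have : IsFiniteMeasure a := isFiniteMeasure_of_le l₁ ha
  have : IsFiniteMeasure b := isFiniteMeasure_of_le l₂ hb
  suffices h0 : a = 0 by
    have hb0 : b = 0 := by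
      have := congrArg (fun m => m Set.univ) hab
      have e : l₁ Set.univ = l₂ Set.univ := by
        rw [← Measure.fst_univ, ← Measure.fst_univ, hf]
      simp only [Measure.add_apply, e, h0, Measure.coe_zero, Pi.zero_apply] at this
      simpa using this
    simpa [h0, hb0] using hab
  rcases isEmpty_or_nonempty (W × Y) with hE | hE
  · exact Measure.eq_zero_of_isEmpty a
  have : Nonempty W := hE.map Prod.fst
  have : Nonempty Y := hE.map Prod.snd
  have hfst : a.fst = b.fst := by
    have := congrArg Measure.fst hab
    simp only [Measure.fst_add, hf] at this
    exact ((Measure.add_right_inj _ _ _).1 this).symm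
  have hsnd : a.snd = b.snd := by
    have := congrArg Measure.snd hab
    simp only [Measure.snd_add, hs] at this
    exact ((Measure.add_right_inj _ _ _).1 this).symm
  have ha' : ∀ᵐ p ∂a, p ∈ S ∧ p ∈ s := Filter.Eventually.and (ha.absolutelyContinuous.ae_le h1) has
  have hb' : ∀ᵐ p ∂b, p ∈ S ∧ p ∉ s :=
    Filter.Eventually.and (hb.absolutelyContinuous.ae_le h2) (by rw [ae_iff]; simpa using hbs)
  -- `G` is the law of a half path `(w, y, y')` with `(w, y)` distributed by `b` and `(w, y')` by
  -- `a`. As `a.snd = b.snd`, the points `y` and `y'` have the same law, so two copies of `G` can be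
  -- joined: the exit point of one is the entry point of the next.
  obtain ⟨G, hGf, hGb, hGa⟩ := exists_glue b a hfst.symm
  have m1 : Measurable fun p : W × (Y × Y) => (p.2.2, (p.1, p.2.1)) := by fun_prop
  have m2 : Measurable fun p : W × (Y × Y) => (p.2.1, (p.1, p.2.2)) := by fun_prop
  have hG : (G.map fun p => (p.2.2, (p.1, p.2.1))).fst =
      (G.map fun p => (p.2.1, (p.1, p.2.2))).fst := by
    rw [Measure.fst, Measure.fst, Measure.map_map measurable_fst m1,
      Measure.map_map measurable_fst m2]
    rw [← hGa, ← hGb, Measure.snd, Measure.snd, Measure.map_map measurable_snd (by fun_prop),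
      Measure.map_map measurable_snd (by fun_prop)] at hsnd
    exact hsnd
  obtain ⟨C, hCf, hC1, hC2⟩ := exists_glue _ _ hG
  have hGae : ∀ᵐ p ∂G, ((p.1, p.2.1) ∈ S ∧ (p.1, p.2.1) ∉ s) ∧
      ((p.1, p.2.2) ∈ S ∧ (p.1, p.2.2) ∈ s) := by
    rw [← hGb] at hb'
    rw [← hGa] at ha'
    exact (ae_of_ae_map (by fun_prop) hb').and (ae_of_ae_map (by fun_prop) ha')
  have q1 : Measurable fun p : Y × ((W × Y) × (W × Y)) => (p.2.1.1, (p.2.1.2, p.1)) := by fun_prop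
  have q2 : Measurable fun p : Y × ((W × Y) × (W × Y)) => (p.2.2.1, (p.1, p.2.2.2)) := by fun_prop
  have r1 : Measurable fun p : Y × ((W × Y) × (W × Y)) => (p.1, p.2.1) := by fun_prop
  have r2 : Measurable fun p : Y × ((W × Y) × (W × Y)) => (p.1, p.2.2) := by fun_prop
  have t1 : Measurable fun p : Y × (W × Y) => (p.2.1, (p.2.2, p.1)) := by fun_prop
  have t2 : Measurable fun p : Y × (W × Y) => (p.2.1, (p.1, p.2.2)) := by fun_prop
  have hC1' : C.map (fun p => (p.2.1.1, (p.2.1.2, p.1))) = G := by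
    have := congrArg (Measure.map fun p : Y × (W × Y) => (p.2.1, (p.2.2, p.1))) hC1
    rw [Measure.map_map t1 r1, Measure.map_map t1 m1] at this
    simpa [Function.comp_def] using this
  have hC2' : C.map (fun p => (p.2.2.1, (p.1, p.2.2.2))) = G := by
    have := congrArg (Measure.map fun p : Y × (W × Y) => (p.2.1, (p.1, p.2.2))) hC2
    rw [Measure.map_map t2 r2, Measure.map_map t2 m2] at this
    simpa [Function.comp_def] using this
  let f : W × (Y × Y) → ℝ := fun p => chainHeight (h p.2.1) (h p.2.2)
  have hfm : Measurable f := measurable_chainHeight.comp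
    ((hh.comp measurable_snd.fst).prodMk (hh.comp measurable_snd.snd))
  have i1 : ∫ p, f (p.2.1.1, (p.2.1.2, p.1)) ∂C = ∫ p, f p ∂G := by
    rw [← hC1', integral_map (by fun_prop) hfm.aestronglyMeasurable]
  have i2 : ∫ p, f (p.2.2.1, (p.1, p.2.2.2)) ∂C = ∫ p, f p ∂G := by
    rw [← hC2', integral_map (by fun_prop) hfm.aestronglyMeasurable]
  have n1 : Integrable (fun p => f (p.2.1.1, (p.2.1.2, p.1))) C :=
    .of_bound (hfm.comp q1).aestronglyMeasurable (2 * Real.pi)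
      (.of_forall fun _ => abs_chainHeight_le _ _)
  have n2 : Integrable (fun p => f (p.2.2.1, (p.1, p.2.2.2))) C :=
    .of_bound (hfm.comp q2).aestronglyMeasurable (2 * Real.pi)
      (.of_forall fun _ => abs_chainHeight_le _ _)
  have hlt : ∀ᵐ p ∂C, f (p.2.1.1, (p.2.1.2, p.1)) < f (p.2.2.1, (p.1, p.2.2.2)) := by
    have g1 := hGae
    have g2 := hGae
    rw [← hC1'] at g1
    rw [← hC2'] at g2
    filter_upwards [ae_of_ae_map q1.aemeasurable g1, ae_of_ae_map q2.aemeasurable g2]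
      with p hp1 hp2
    obtain ⟨y, ⟨w₁, y₁⟩, ⟨w₂, y₂⟩⟩ := p
    obtain ⟨⟨u1, u2⟩, u3, u4⟩ := hp1
    obtain ⟨⟨v1, v2⟩, v3, v4⟩ := hp2
    simp only at u1 u2 u3 u4 v1 v2 v3 v4
    refine chainHeight_lt ?_
    by_contra hcon
    push Not at hcon
    -- The edges of the path lie alternately outside and inside `s`, so any coincidence would put
    -- one edge on both sides.
    exact hS w₁ w₂ y y₁ y₂ (by rintro rfl; exact v2 u4) (by rintro rfl; exact u2 u4)
      (by rintro rfl; exact v2 v4) u3 u1 v1 v3 hcon.1 hcon.2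
  have hC0 : C = 0 := by
    -- Both halves have law `G`, so the strictly positive increment has integral zero; this is
    -- possible only for the zero measure.
    have e0 : ∫ p, (f (p.2.2.1, (p.1, p.2.2.2)) - f (p.2.1.1, (p.2.1.2, p.1))) ∂C = 0 := by
      rw [integral_sub n2 n1, i1, i2, sub_self]
    rw [integral_eq_zero_iff_of_nonneg_ae (hlt.mono fun p hp => sub_nonneg.2 hp.le)
      (n2.sub n1)] at e0
    have : ∀ᵐ p ∂C, False := by
      filter_upwards [e0, hlt] with p p1 p2
      exact absurd (sub_eq_zero.1 p1) p2.ne'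
    simpa [ae_iff] using this
  rw [← hGa, ← hC1', hC0]
  simp

/-! ### Extreme sets and the lexicographic height -/

/-- A real function of `y` that orders points first by the index of the piece of the partition
that contains them, and then by decreasing value of `ψ`. -/
noncomputable def lexHeight {Y : Type*} {K : ℕ} (P : Fin K → Set Y) (ψ : Y → ℝ) (y : Y) : ℝ :=
  ∑ k, (P k).indicator (fun _ => (k.val : ℝ)) y - Real.arctan (ψ y) / 4

lemma measurable_lexHeight {Y : Type*} [MeasurableSpace Y] {K : ℕ} {P : Fin K → Set Y}
    (hP : IsOrderedPartition P) {ψ : Y → ℝ} (hψ : Measurable ψ) :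
    Measurable (lexHeight P ψ) :=
  (Finset.measurable_fun_sum _ fun k _ => measurable_const.indicator (hP.1 k)).sub
    ((Real.measurable_arctan.comp hψ).div_const 4)

lemma lexHeight_of_mem {Y : Type*} [MeasurableSpace Y] {K : ℕ} {P : Fin K → Set Y}
    (hP : IsOrderedPartition P) (ψ : Y → ℝ) {y : Y} {k : Fin K} (hy : y ∈ P k) :
    lexHeight P ψ y = k.val - Real.arctan (ψ y) / 4 := by
  rw [lexHeight, Finset.sum_eq_single k, Set.indicator_of_mem hy]
  · exact fun l _ hl => Set.indicator_of_notMem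
      (fun h => Set.disjoint_left.1 (hP.2.1 hl) h hy) _
  · simp

/-- Two values of `arctan / 4` differ by less than `π / 4 < 1`, so they never outweigh a difference
of indices. -/
lemma le_of_lexHeight_le {Y : Type*} [MeasurableSpace Y] {K : ℕ} {P : Fin K → Set Y}
    (hP : IsOrderedPartition P) (ψ : Y → ℝ) {y y' : Y} {k k' : Fin K} (hy : y ∈ P k)
    (hy' : y' ∈ P k') (h : lexHeight P ψ y' ≤ lexHeight P ψ y) :
    k' ≤ k ∧ (k' = k → ψ y ≤ ψ y') := by
  rw [lexHeight_of_mem hP ψ hy, lexHeight_of_mem hP ψ hy'] at h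
  have h1 := Real.arctan_lt_pi_div_two (ψ y)
  have h2 := Real.neg_pi_div_two_lt_arctan (ψ y)
  have h3 := Real.arctan_lt_pi_div_two (ψ y')
  have h4 := Real.neg_pi_div_two_lt_arctan (ψ y')
  have h5 := Real.pi_lt_four
  constructor
  · have : (k'.val : ℝ) < k.val + 1 := by linarith
    exact Fin.le_def.2 (by exact_mod_cast Nat.lt_succ_iff.1 (by exact_mod_cast this))
  · rintro rfl
    exact Real.arctan_strictMono.le_iff_le.1 (by linarith)

/-- If `y` is itself the maximizer at hand, a point `y'` of the fiber that is no higher lies in the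
same piece, by minimality of the index, and has at least the same `ψ`. Since `Φ w` is common to
both, `y'` is a maximizer too. -/
lemma exists_mem_argmaxMap_ne {W Y : Type*} [MeasurableSpace Y] {K : ℕ} {b : W × Y → ℝ}
    {P : Fin K → Set Y} (hP : IsOrderedPartition P) {S : Set (W × Y)} {Φ : W → ℝ} {ψ : Y → ℝ}
    (hb : ∀ p ∈ S, b p = Φ p.1 + ψ p.2) {w : W} (hw : (argmaxMap b P S w).Nonempty)
    {y y' : Y} (hy' : (w, y') ∈ S) (hne : y' ≠ y)
    (hle : lexHeight P ψ y' ≤ lexHeight P ψ y) : ∃ a ∈ argmaxMap b P S w, a ≠ y := by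
  obtain ⟨a, ha⟩ := hw
  by_cases hay : a = y
  · subst hay
    refine ⟨y', ?_, hne⟩
    obtain ⟨κ, hκ, ⟨haS, haP⟩, hmax⟩ := ha
    obtain ⟨k, hk⟩ : ∃ k, y' ∈ P k := by
      have : y' ∈ ⋃ k, P k := hP.2.2 ▸ Set.mem_univ y'
      simpa using this
    obtain ⟨h1, h2⟩ := le_of_lexHeight_le hP ψ haP hk hle
    obtain rfl : k = κ := le_antisymm h1 (hκ.2 ⟨y', hy', hk⟩)
    refine ⟨k, hκ, ⟨hy', hk⟩, fun z hz => (hmax z hz).trans ?_⟩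
    have e1 : b (w, a) = Φ w + ψ a := hb _ haS
    have e2 : b (w, y') = Φ w + ψ y' := hb _ hy'
    rw [e1, e2]
    linarith [h2 rfl]
  · exact ⟨a, ha, hay⟩

/-- An extreme set on which the cost splits as a sum carries at most one finite measure with
given marginals. -/
theorem IsExtremeSet.measure_eq {W Y : Type*} [MeasurableSpace W] [MeasurableSpace Y]
    [StandardBorelSpace W] [StandardBorelSpace Y] {K : ℕ} {b : W × Y → ℝ} {P : Fin K → Set Y}
    {S : Set (W × Y)} {ρ : Measure W} {ν : Measure Y} (hext : IsExtremeSet b P S ρ ν)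
    (hP : IsOrderedPartition P) {Φ : W → ℝ} {ψ : Y → ℝ} (hψ : Measurable ψ)
    (hb : ∀ p ∈ S, b p = Φ p.1 + ψ p.2)
    {l₁ l₂ : Measure (W × Y)} [IsFiniteMeasure l₁] [IsFiniteMeasure l₂]
    (f₁ : l₁.fst = ρ) (f₂ : l₂.fst = ρ) (s₁ : l₁.snd = ν) (s₂ : l₂.snd = ν)
    (h₁ : ∀ᵐ p ∂l₁, p ∈ S) (h₂ : ∀ᵐ p ∂l₂, p ∈ S) : l₁ = l₂ := by
  obtain ⟨M, T, hM, hT, hdom, hdisj⟩ := hext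
  have key : ∀ l : Measure (W × Y), l.fst = ρ → l.snd = ν → (∀ᵐ p ∂l, p ∈ S) →
      ∀ᵐ p ∂l, p ∈ S ∩ M ×ˢ T := by
    intro l f s h
    have a1 : ∀ᵐ w ∂l.fst, w ∈ M := by rw [f]; exact hM
    have a2 : ∀ᵐ y ∂l.snd, y ∈ T := by rw [s]; exact hT
    filter_upwards [h, ae_of_ae_map measurable_fst.aemeasurable a1,
      ae_of_ae_map measurable_snd.aemeasurable a2] with p p1 p2 p3
    exact ⟨p1, p2, p3⟩
  refine measure_eq_of_no_local_max (S ∩ M ×ˢ T) (lexHeight P ψ) (measurable_lexHeight hP hψ) ?_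
    l₁ l₂ (f₁.trans f₂.symm) (s₁.trans s₂.symm) (key l₁ f₁ s₁ h₁) (key l₂ f₂ s₂ h₂)
  intro w₁ w₂ y y₁ y₂ hw hy₁ hy₂ a₁ b₁ a₂ b₂ le₁ le₂
  have d₁ : w₁ ∈ setDom (fiberMap S) ∩ M := ⟨⟨y, a₁.1⟩, a₁.2.1⟩
  have d₂ : w₂ ∈ setDom (fiberMap S) ∩ M := ⟨⟨y, a₂.1⟩, a₂.2.1⟩
  have n₁ := d₁
  have n₂ := d₂
  rw [hdom] at n₁ n₂
  obtain ⟨z₁, hz₁, e₁⟩ := exists_mem_argmaxMap_ne hP hb n₁.1 b₁.1 hy₁ le₁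
  obtain ⟨z₂, hz₂, e₂⟩ := exists_mem_argmaxMap_ne hP hb n₂.1 b₂.1 hy₂ le₂
  have : y ∈ (fiberMap S w₁ \ {z₁}) ∩ (fiberMap S w₂ \ {z₂}) ∩ T :=
    ⟨⟨⟨a₁.1, e₁.symm⟩, ⟨a₂.1, e₂.symm⟩⟩, a₁.2.2⟩
  rw [hdisj w₁ d₁ w₂ d₂ hw z₁ hz₁ z₂ hz₂] at this
  exact this

/-! ### Kantorovich duality by Hahn–Banach and Riesz -/

section Duality

variable {N : ℕ} {E : Fin N → Type*} [∀ i, MeasurableSpace (E i)]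

lemma IsPlan.integral_comp {μ : ∀ i, Measure (E i)} {lam : Measure (∀ i, E i)}
    (h : IsPlan μ lam) {i : Fin N} {f : E i → ℝ} (hf : Integrable f (μ i)) :
    Integrable (fun x : ∀ i, E i => f (x i)) lam ∧ ∫ x, f (x i) ∂lam = ∫ y, f y ∂(μ i) := by
  rw [← h.2 i] at hf ⊢
  have hm : AEMeasurable (fun x : ∀ i, E i => x i) lam := (measurable_pi_apply i).aemeasurable
  exact ⟨hf.comp_aemeasurable hm, (integral_map hm hf.aestronglyMeasurable).symm⟩

lemma IsPlan.integral_sum {μ : ∀ i, Measure (E i)} {lam : Measure (∀ i, E i)}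
    (h : IsPlan μ lam) {f : ∀ i, E i → ℝ} (hf : ∀ i, Integrable (f i) (μ i)) :
    Integrable (fun x : ∀ i, E i => ∑ i, f i (x i)) lam ∧
      ∫ x, ∑ i, f i (x i) ∂lam = ∑ i, ∫ y, f i y ∂(μ i) := by
  refine ⟨integrable_finsetSum _ fun i _ => (h.integral_comp (hf i)).1, ?_⟩
  rw [integral_finsetSum _ fun i _ => (h.integral_comp (hf i)).1]
  exact Finset.sum_congr rfl fun i _ => (h.integral_comp (hf i)).2

lemma isPlan_pi (μ : ∀ i, Measure (E i)) [∀ i, IsProbabilityMeasure (μ i)] :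
    IsPlan μ (Measure.pi μ) :=
  ⟨inferInstance, fun i => (measurePreserving_eval μ i).map_eq⟩

lemma integrable_of_continuous {Z : Type*} [TopologicalSpace Z] [CompactSpace Z]
    [MeasurableSpace Z] [BorelSpace Z] (ν : Measure Z) [IsFiniteMeasure ν] (f : C(Z, ℝ)) :
    Integrable f ν :=
  .of_bound f.continuous.measurable.aestronglyMeasurable ‖f‖ (.of_forall f.norm_coe_le_norm)

variable [∀ i, TopologicalSpace (E i)]

/-- The values of the linear program whose optimal value is a sublinear function of `g`: a plan
that attains the dual value `V` is obtained from a linear functional below that function. -/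
def dualValues (c : C(∀ i, E i, ℝ)) (μ : ∀ i, Measure (E i)) (V : ℝ) (g : C(∀ i, E i, ℝ)) :
    Set ℝ :=
  {r | ∃ (ψ : ∀ i, C(E i, ℝ)) (t : ℝ), 0 ≤ t ∧ (∀ x, g x ≤ ∑ i, ψ i (x i) + t * c x) ∧
    r = ∑ i, ∫ y, ψ i y ∂(μ i) + t * V}

lemma dualValues_smul {c : C(∀ i, E i, ℝ)} {μ : ∀ i, Measure (E i)} {V : ℝ}
    {g : C(∀ i, E i, ℝ)} {r s : ℝ} (hs : 0 ≤ s) (h : r ∈ dualValues c μ V g) :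
    s * r ∈ dualValues c μ V (s • g) := by
  obtain ⟨ψ, t, ht, hg, rfl⟩ := h
  refine ⟨fun i => s • ψ i, s * t, mul_nonneg hs ht, fun x => ?_, ?_⟩
  · simp only [ContinuousMap.smul_apply, smul_eq_mul, ← Finset.mul_sum]
    nlinarith [mul_le_mul_of_nonneg_left (hg x) hs]
  · simp only [ContinuousMap.smul_apply, smul_eq_mul, integral_const_mul, ← Finset.mul_sum]
    ring

variable [∀ i, CompactSpace (E i)]

lemma dualValues_nonempty (c : C(∀ i, E i, ℝ)) (μ : ∀ i, Measure (E i)) (V : ℝ)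
    (hN : 0 < N) (g : C(∀ i, E i, ℝ)) : (dualValues c μ V g).Nonempty := by
  refine ⟨_, fun _ => ContinuousMap.const _ (‖g‖ / N), 0, le_rfl, fun x => ?_, rfl⟩
  have : (N : ℝ) ≠ 0 := by positivity
  simp only [ContinuousMap.const_apply, Finset.sum_const, Finset.card_univ, Fintype.card_fin,
    nsmul_eq_mul, zero_mul, add_zero]
  rw [mul_div_cancel₀ _ this]
  exact (le_abs_self _).trans (g.norm_coe_le_norm x)

variable [∀ i, BorelSpace (E i)]

lemma dualValues_add {c : C(∀ i, E i, ℝ)} {μ : ∀ i, Measure (E i)}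
    [∀ i, IsProbabilityMeasure (μ i)] {V : ℝ} {g g' : C(∀ i, E i, ℝ)} {r r' : ℝ}
    (h : r ∈ dualValues c μ V g) (h' : r' ∈ dualValues c μ V g') :
    r + r' ∈ dualValues c μ V (g + g') := by
  obtain ⟨ψ, t, ht, hg, rfl⟩ := h
  obtain ⟨ψ', t', ht', hg', rfl⟩ := h'
  refine ⟨fun i => ψ i + ψ' i, t + t', add_nonneg ht ht', fun x => ?_, ?_⟩
  · simp only [ContinuousMap.add_apply, Finset.sum_add_distrib]
    linarith [hg x, hg' x]
  · have : ∀ i, ∫ y, (ψ i + ψ' i) y ∂(μ i) = ∫ y, ψ i y ∂(μ i) + ∫ y, ψ' i y ∂(μ i) := fun i =>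
      integral_add (integrable_of_continuous (μ i) (ψ i)) (integrable_of_continuous (μ i) (ψ' i))
    simp only [this, Finset.sum_add_distrib]
    ring

/-- Makes the infimum of the dual values finite. For `t = 0` the constraint is integrated against
the product measure. For `t > 0` it says that the functions `(-ψ_i - ‖g‖ / N) / t` are dual
admissible, so that `V` bounds the sum of their integrals. -/
lemma neg_norm_le_of_mem_dualValues {c : C(∀ i, E i, ℝ)} {μ : ∀ i, Measure (E i)}
    [∀ i, IsProbabilityMeasure (μ i)] {V : ℝ} (hN : 0 < N)
    (hV : ∀ ψ, IsDualAdmissible c μ ψ → ∑ i, ∫ x, ψ i x ∂(μ i) ≤ V)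
    {g : C(∀ i, E i, ℝ)} {r : ℝ} (h : r ∈ dualValues c μ V g) : -‖g‖ ≤ r := by
  obtain ⟨ψ, t, ht, hg, rfl⟩ := h
  have hN' : (N : ℝ) ≠ 0 := by positivity
  have hg' : ∀ x, -‖g‖ ≤ ∑ i, ψ i (x i) + t * c x := fun x =>
    (abs_le.1 (g.norm_coe_le_norm x)).1.trans (hg x)
  have hint := fun i => integrable_of_continuous (μ i) (ψ i)
  rcases ht.eq_or_lt with rfl | ht
  · have hp := (isPlan_pi μ).integral_sum hint
    rw [← hp.2, zero_mul, add_zero]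
    have := integral_mono (integrable_const (-‖g‖)) hp.1
      (fun x => by simpa using hg' x)
    simpa using this
  · have hi : ∀ i, Integrable (fun y => (-ψ i y - ‖g‖ / N) / t) (μ i) := fun i =>
      ((hint i).neg.sub (integrable_const _)).div_const t
    have := hV (fun i y => (-ψ i y - ‖g‖ / N) / t) ⟨hi, fun x => by
      rw [← Finset.sum_div, Finset.sum_sub_distrib, Finset.sum_neg_distrib, Finset.sum_const,
        Finset.card_univ, Fintype.card_fin, nsmul_eq_mul, mul_div_cancel₀ _ hN',
        div_le_iff₀ ht]
      linarith [hg' x]⟩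
    have e : ∀ i, ∫ y, (-ψ i y - ‖g‖ / N) / t ∂(μ i) = (-∫ y, ψ i y ∂(μ i) - ‖g‖ / N) / t := by
      intro i
      have hneg : Integrable (fun y => -ψ i y) (μ i) := (hint i).neg
      rw [integral_div, integral_sub hneg (integrable_const _), integral_neg]
      simp
    simp only [e] at this
    rw [← Finset.sum_div, Finset.sum_sub_distrib, Finset.sum_neg_distrib, Finset.sum_const,
        Finset.card_univ, Fintype.card_fin, nsmul_eq_mul, mul_div_cancel₀ _ hN',
        div_le_iff₀ ht] at this
    linarith

/-- A linear functional dominated by the dual values. -/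
lemma exists_linearMap_le_dualValues {c : C(∀ i, E i, ℝ)} {μ : ∀ i, Measure (E i)}
    [∀ i, IsProbabilityMeasure (μ i)] {V : ℝ} (hN : 0 < N)
    (hV : ∀ ψ, IsDualAdmissible c μ ψ → ∑ i, ∫ x, ψ i x ∂(μ i) ≤ V) :
    ∃ L : C(∀ i, E i, ℝ) →ₗ[ℝ] ℝ, ∀ g, ∀ r ∈ dualValues c μ V g, L g ≤ r := by
  have hne := dualValues_nonempty c μ V hN
  have hbd : ∀ g, BddBelow (dualValues c μ V g) := fun g =>
    ⟨-‖g‖, fun r hr => neg_norm_le_of_mem_dualValues hN hV hr⟩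
  have hsmul : ∀ s : ℝ, 0 < s → ∀ g,
      sInf (dualValues c μ V (s • g)) ≤ s * sInf (dualValues c μ V g) := by
    intro s hs g
    rw [← div_le_iff₀' hs]
    refine le_csInf (hne g) fun r hr => ?_
    rw [div_le_iff₀' hs]
    exact csInf_le (hbd _) (dualValues_smul hs.le hr)
  have hN_hom : ∀ s : ℝ, 0 < s → ∀ g,
      sInf (dualValues c μ V (s • g)) = s * sInf (dualValues c μ V g) := by
    intro s hs g
    refine le_antisymm (hsmul s hs g) ?_
    have := hsmul s⁻¹ (inv_pos.2 hs) (s • g)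
    rwa [inv_smul_smul₀ hs.ne', le_inv_mul_iff₀ hs] at this
  have hadd : ∀ g g', sInf (dualValues c μ V (g + g')) ≤
      sInf (dualValues c μ V g) + sInf (dualValues c μ V g') := by
    intro g g'
    rw [← sub_le_iff_le_add]
    refine le_csInf (hne g) fun r' hr' => ?_
    rw [sub_le_comm]
    refine le_csInf (hne g') fun r hr => ?_
    rw [sub_le_iff_le_add']
    exact csInf_le (hbd _) (dualValues_add hr' hr)
  obtain ⟨L, -, hL⟩ := exists_extension_of_le_sublinear (⊥ : C(∀ i, E i, ℝ) →ₗ.[ℝ] ℝ)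
    (fun g => sInf (dualValues c μ V g)) hN_hom hadd (by
      rintro ⟨x, hx⟩
      obtain rfl : x = 0 := (Submodule.mem_bot ℝ).1 hx
      -- Homogeneity is known for positive factors only; the factor `2` makes the value at `0` equal
      -- to its double.
      have h0 := hN_hom 2 (by norm_num) 0
      rw [smul_zero] at h0
      have e : sInf (dualValues c μ V (0 : C(∀ i, E i, ℝ))) = 0 := by linarith
      have : (⊥ : C(∀ i, E i, ℝ) →ₗ.[ℝ] ℝ) ⟨0, hx⟩ = 0 := LinearPMap.map_zero _
      rw [this]
      exact e.ge)
  exact ⟨L, fun g r hr => (hL g).trans (csInf_le (hbd g) hr)⟩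

open CompactlySupported in
/-- The Riesz–Markov–Kakutani theorem on a compact space. -/
lemma exists_measure_of_nonneg {Z : Type*} [TopologicalSpace Z] [T2Space Z] [CompactSpace Z]
    [MeasurableSpace Z] [BorelSpace Z] (L : C(Z, ℝ) →ₗ[ℝ] ℝ) (hL : ∀ g, 0 ≤ g → 0 ≤ L g) :
    ∃ ν : Measure Z, IsFiniteMeasure ν ∧ ∀ g : C(Z, ℝ), ∫ z, g z ∂ν = L g := by
  let J : C_c(Z, ℝ) →ₗ[ℝ] C(Z, ℝ) :=
    { toFun := fun f => f.toContinuousMap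
      map_add' := fun _ _ => rfl
      map_smul' := fun _ _ => rfl }
  let Λ : C_c(Z, ℝ) →ₚ[ℝ] ℝ := PositiveLinearMap.mk₀ (L ∘ₗ J) fun f hf => hL _ fun x => hf x
  refine ⟨RealRMK.rieszMeasure Λ, inferInstance, fun g => ?_⟩
  exact RealRMK.integral_rieszMeasure Λ (CompactlySupportedContinuousMap.continuousMapEquiv g)

variable [∀ i, T2Space (E i)] [∀ i, HasOuterApproxClosed (E i)] [BorelSpace (∀ i, E i)]

/-- Kantorovich duality for continuous costs on compact spaces: some plan has cost at most `V`
if `V` is an upper bound for the dual problem. -/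
theorem exists_isPlan_integral_le {c : C(∀ i, E i, ℝ)} {μ : ∀ i, Measure (E i)}
    [∀ i, IsProbabilityMeasure (μ i)] {V : ℝ} (hN : 0 < N)
    (hV : ∀ ψ, IsDualAdmissible c μ ψ → ∑ i, ∫ x, ψ i x ∂(μ i) ≤ V) :
    ∃ lam, IsPlan μ lam ∧ ∫ x, c x ∂lam ≤ V := by
  obtain ⟨L, hL⟩ := exists_linearMap_le_dualValues hN hV
  obtain ⟨lam, hfin, hlam⟩ := exists_measure_of_nonneg L (fun g hg => by
    -- Zero potentials and `t = 0` are admissible for `-g ≤ 0`, which gives positivity of `L`.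
    have := hL (-g) 0 ⟨fun _ => 0, 0, le_rfl, fun x => by simpa using hg x, by simp⟩
    rw [map_neg] at this
    linarith)
  have hle : ∀ (i : Fin N) (f : C(E i, ℝ)), ∫ x, f (x i) ∂lam ≤ ∫ y, f y ∂(μ i) := by
    intro i f
    classical
    have := hL (f.comp ⟨fun x => x i, continuous_apply i⟩) (∫ y, f y ∂(μ i))
      ⟨Pi.single i f, 0, le_rfl, fun x => by
        rw [Finset.sum_eq_single i]
        · simp
        · intro j _ hj
          simp [Pi.single_eq_of_ne hj]
        · simp, by
        rw [Finset.sum_eq_single i]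
        · simp
        · intro j _ hj
          simp [Pi.single_eq_of_ne hj]
        · simp⟩
    rwa [← hlam] at this
  have hmarg : ∀ i, lam.map (fun x => x i) = μ i := by
    intro i
    refine ext_of_forall_integral_eq_of_IsFiniteMeasure fun f => ?_
    rw [integral_map (measurable_pi_apply i).aemeasurable
      f.continuous.measurable.aestronglyMeasurable]
    refine le_antisymm (hle i f.toContinuousMap) ?_
    -- The one-sided bound for `-f` is the reverse bound for `f`.
    have := hle i (-f.toContinuousMap)
    simp only [ContinuousMap.neg_apply, integral_neg] at this
    exact neg_le_neg_iff.1 this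
  refine ⟨lam, ⟨⟨?_⟩, hmarg⟩, ?_⟩
  · have := congrArg (fun m => m Set.univ) (hmarg ⟨0, hN⟩)
    simpa [Measure.map_apply (measurable_pi_apply _) MeasurableSet.univ] using this
  · rw [hlam]
    -- The variable `t` serves this step: zero potentials and `t = 1` are admissible for `g = c` and
    -- have value `V`.
    exact hL c V ⟨fun _ => 0, 1, zero_le_one, fun x => by simp, by simp⟩

/-- Existence of an optimal plan; every optimal plan is concentrated on the minimizing set. -/
theorem AreContinuousPotentials.exists_isOptimalPlan {c : (∀ i, E i) → ℝ} (hc : Continuous c)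
    {μ : ∀ i, Measure (E i)} [∀ i, IsProbabilityMeasure (μ i)] (hN : 0 < N)
    {φ : ∀ i, E i → ℝ} (hφ : AreContinuousPotentials c μ φ) :
    (∃ lam, IsOptimalPlan c μ lam) ∧
      ∀ lam, IsOptimalPlan c μ lam → ∀ᵐ x ∂lam, x ∈ minimizingSet c φ := by
  obtain ⟨hcont, hadm, hmax⟩ := hφ
  obtain ⟨l₀, hl₀, hle⟩ := exists_isPlan_integral_le (c := ⟨c, hc⟩) hN hmax
  have hci : ∀ lam, IsPlan μ lam → Integrable c lam := fun lam h => by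
    have := h.1
    exact integrable_of_continuous lam ⟨c, hc⟩
  have hge : ∀ lam, IsPlan μ lam → ∑ i, ∫ y, φ i y ∂(μ i) ≤ ∫ x, c x ∂lam := fun lam h => by
    have hs := h.integral_sum hadm.1
    rw [← hs.2]
    exact integral_mono hs.1 (hci lam h) hadm.2
  refine ⟨⟨l₀, hl₀, fun l h => hle.trans (hge l h)⟩, fun l hl => ?_⟩
  have hs := hl.1.integral_sum hadm.1
  have e : ∫ x, (c x - ∑ i, φ i (x i)) ∂l = 0 := by
    rw [integral_sub (hci l hl.1) hs.1, hs.2]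
    exact sub_eq_zero.2 (le_antisymm ((hl.2 l₀ hl₀).trans hle) (hge l hl.1))
  rw [integral_eq_zero_iff_of_nonneg (fun x => sub_nonneg.2 (hadm.2 x))
    ((hci l hl.1).sub hs.1)] at e
  exact e.mono fun x hx => sub_eq_zero.1 hx

end Duality

/-! ### Splitting of the reduced cost and induction over the coordinates -/

section Induction

variable {N : ℕ} {E : Fin N → Type*}

/-- The dual constraint bounds every competitor in the infimum below by the sum of the potentials up
to `j`; the point `x` attains this bound. -/
lemma reducedCost_of_mem_minimizingSet {c : (∀ i, E i) → ℝ} {φ : ∀ i, E i → ℝ}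
    (hle : ∀ x, ∑ i, φ i (x i) ≤ c x) (j : Fin N) {x : ∀ i, E i} (hx : x ∈ minimizingSet c φ) :
    reducedCost c φ j (projLE j x) = ∑ i : Set.Iio j, φ i (x i) + φ j (x j) := by
  classical
  have split : ∀ y : ∀ i, E i, ∑ i, φ i (y i) =
      (∑ i : Set.Iio j, φ i (y i) + φ j (y j)) + ∑ i ∈ Finset.Ioi j, φ i (y i) := by
    intro y
    have h1 : (Finset.univ : Finset (Fin N)) = insert j (Finset.Iio j) ∪ Finset.Ioi j := by
      ext i
      simp only [Finset.mem_univ, Finset.mem_union, Finset.mem_insert, Finset.mem_Iio,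
        Finset.mem_Ioi, true_iff]
      rcases lt_trichotomy i j with h | h | h <;> simp [h]
    have h2 : Disjoint (insert j (Finset.Iio j)) (Finset.Ioi j) := by
      rw [Finset.disjoint_left]
      intro i hi hi'
      simp only [Finset.mem_insert, Finset.mem_Iio] at hi
      rw [Finset.mem_Ioi] at hi'
      rcases hi with rfl | hi
      · exact lt_irrefl _ hi'
      · exact lt_asymm hi hi'
    rw [h1, Finset.sum_union h2, Finset.sum_insert (by simp), add_comm (φ j (y j))]
    congr 2
    exact Finset.sum_subtype _ (by simp) _
  refine IsLeast.csInf_eq ⟨⟨x, rfl, ?_⟩, ?_⟩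
  · have := split x
    rw [← (hx : c x = _)] at this
    exact sub_eq_iff_eq_add.2 this
  · rintro _ ⟨y, hy, rfl⟩
    have h1 : projLT j y = projLT j x := congrArg Prod.fst hy
    have h2 : y j = x j := congrArg Prod.snd hy
    have h3 : ∀ i : Set.Iio j, y i = x i := fun i => congrFun h1 i
    have := hle y
    rw [split y] at this
    simp only [h2, h3] at this
    exact le_sub_iff_add_le.2 this

/-- The coordinates before `j` as a function of the coordinates up to a predecessor `j'`. -/
def projLTOfLE (j j' : Fin N) (h : j.val = j'.val + 1)
    (z : ((i : Set.Iio j') → E i) × E j') : (i : Set.Iio j) → E i := fun i =>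
  if hi : i.1 < j' then z.1 ⟨i.1, hi⟩ else
    (le_antisymm (not_lt.1 hi)
      (Fin.le_def.2 (Nat.lt_succ_iff.1 ((Fin.lt_def.1 i.2).trans_eq h))) : j' = i.1) ▸ z.2

lemma projLTOfLE_projLE (j j' : Fin N) (h : j.val = j'.val + 1) (x : ∀ i, E i) :
    projLTOfLE j j' h (projLE j' x) = projLT j x := by
  funext ⟨i, hi⟩
  unfold projLTOfLE
  split_ifs with h'
  · rfl
  · obtain rfl : j' = i := le_antisymm (not_lt.1 h')
      (Fin.le_def.2 (Nat.lt_succ_iff.1 ((Fin.lt_def.1 hi).trans_eq h)))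
    rfl

variable [∀ i, MeasurableSpace (E i)]

lemma measurable_projLTOfLE (j j' : Fin N) (h : j.val = j'.val + 1) :
    Measurable (projLTOfLE (E := E) j j' h) := by
  refine measurable_pi_lambda _ fun ⟨i, hi⟩ => ?_
  unfold projLTOfLE
  by_cases h' : i < j'
  · simp only [h', dif_pos]
    fun_prop
  · obtain rfl : j' = i := le_antisymm (not_lt.1 h')
      (Fin.le_def.2 (Nat.lt_succ_iff.1 ((Fin.lt_def.1 hi).trans_eq h)))
    simp only [lt_irrefl, dif_neg, not_false_eq_true]
    exact measurable_snd

lemma measurable_projLT (j : Fin N) : Measurable (projLT (E := E) j) :=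
  measurable_pi_lambda _ fun i => measurable_pi_apply i.1

lemma measurable_projLE (j : Fin N) : Measurable (projLE (E := E) j) :=
  (measurable_projLT j).prodMk (measurable_pi_apply j)

lemma fst_map_projLE (j : Fin N) (lam : Measure (∀ i, E i)) :
    (lam.map (projLE j)).fst = lam.map (projLT j) :=
  Measure.fst_map_prodMk (measurable_pi_apply j)

lemma snd_map_projLE (j : Fin N) (lam : Measure (∀ i, E i)) :
    (lam.map (projLE j)).snd = lam.map (fun x => x j) :=
  Measure.snd_map_prodMk (measurable_projLT j)

/-- Two plans agree on the first coordinates if, inductively, equality of their images under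
`projLT j` implies equality of their images under `projLE j`. -/
lemma IsPlan.map_projLE_eq {μ : ∀ i, Measure (E i)} {l₁ l₂ : Measure (∀ i, E i)}
    (h₁ : IsPlan μ l₁) (h₂ : IsPlan μ l₂)
    (step : ∀ j : Fin N, 0 < j.val → l₁.map (projLT j) = l₂.map (projLT j) →
      l₁.map (projLE j) = l₂.map (projLE j)) (j : Fin N) :
    l₁.map (projLE j) = l₂.map (projLE j) := by
  obtain ⟨m, hm⟩ := j
  induction m with
  | zero =>
    -- No coordinate precedes the first, so the image is determined by the first marginal.
    have : IsEmpty (Set.Iio (⟨0, hm⟩ : Fin N)) := ⟨fun i => Nat.not_lt_zero _ (Fin.lt_def.1 i.2)⟩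
    let g : E ⟨0, hm⟩ → ((i : Set.Iio (⟨0, hm⟩ : Fin N)) → E i) × E ⟨0, hm⟩ :=
      fun y => (fun i => isEmptyElim i, y)
    have hg : Measurable g := measurable_const.prodMk measurable_id
    have e : projLE (E := E) ⟨0, hm⟩ = g ∘ fun x => x ⟨0, hm⟩ := by
      funext x
      exact Prod.ext (Subsingleton.elim _ _) rfl
    rw [e, ← Measure.map_map hg (measurable_pi_apply _),
      ← Measure.map_map hg (measurable_pi_apply _), h₁.2, h₂.2]
  | succ m ih =>
    refine step _ (Nat.succ_pos m) ?_
    have hm' : m < N := Nat.lt_of_succ_lt hm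
    have e : projLT (E := E) ⟨m + 1, hm⟩ =
        projLTOfLE ⟨m + 1, hm⟩ ⟨m, hm'⟩ rfl ∘ projLE ⟨m, hm'⟩ :=
      funext fun x => (projLTOfLE_projLE _ _ rfl x).symm
    rw [e, ← Measure.map_map (measurable_projLTOfLE _ _ rfl) (measurable_projLE _),
      ← Measure.map_map (measurable_projLTOfLE _ _ rfl) (measurable_projLE _), ih hm']

lemma measure_eq_of_map_projLE_eq [∀ i, StandardBorelSpace (E i)] (j : Fin N)
    (hj : ∀ i, i ≤ j) {l₁ l₂ : Measure (∀ i, E i)}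
    (h : l₁.map (projLE j) = l₂.map (projLE j)) : l₁ = l₂ := by
  -- An injective measurable map between standard Borel spaces is a measurable embedding
  -- (Lusin–Souslin), so the image measure determines the measure.
  have he := (measurable_projLE (E := E) j).measurableEmbedding (projLE_last_injective j hj)
  rw [← he.comap_map l₁, h, he.comap_map]

end Induction

/-! ### Uniqueness of the optimal plan -/

theorem theorem7p5 {n N : ℕ} (hN : 2 ≤ N)
    (X : Fin N → Set (EuclideanSpace ℝ (Fin n))) (hX : ∀ i, IsCompact (X i))
    (μ : ∀ i, Measure (X i)) (hμ : ∀ i, IsProbabilityMeasure (μ i))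
    (K : Fin N → ℕ) (P : ∀ i, Fin (K i) → Set (X i))
    (hP : ∀ i : Fin N, 0 < i.val → IsOrderedPartition (P i))
    (c : (∀ i, X i) → ℝ) (hc : Continuous c)
    (φ : ∀ i, X i → ℝ) (hφ : AreContinuousPotentials c μ φ)
    -- the index `j.val = N - 1` is the condition on the minimizing set itself, with the cost `c`
    (hext : ∀ lam, IsOptimalPlan c μ lam → ∀ j : Fin N, 0 < j.val →
      IsExtremeSet (reducedCost c φ j) (P j) (projLE j '' minimizingSet c φ)
        (lam.map (projLT j)) (μ j)) :
    ∃! lam : Measure (∀ i, X i), IsOptimalPlan c μ lam := by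
  have : ∀ i, CompactSpace (X i) := fun i => isCompact_iff_compactSpace.1 (hX i)
  have : ∀ i, StandardBorelSpace (X i) := fun i => (hX i).measurableSet.standardBorel
  obtain ⟨⟨lam, hlam⟩, hconc⟩ := hφ.exists_isOptimalPlan hc (by omega)
  refine ⟨lam, hlam, fun lam' hlam' => ?_⟩
  have := hlam.1.1
  have := hlam'.1.1
  have hmem : ∀ (j : Fin N) (l : Measure (∀ i, X i)), IsOptimalPlan c μ l →
      ∀ᵐ z ∂l.map (projLE j), z ∈ projLE j '' minimizingSet c φ := by
    intro j l hl
    have hclosed : IsClosed (minimizingSet c φ) := isClosed_eq hc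
      (continuous_finsetSum _ fun i _ => (hφ.1 i).comp (continuous_apply i))
    have hcont : Continuous (projLE (E := fun i => X i) j) :=
      (continuous_pi fun i => continuous_apply i.1).prodMk (continuous_apply j)
    -- The projected minimizing set is compact, hence measurable.
    exact (mem_ae_map_iff (measurable_projLE j).aemeasurable
      (hclosed.isCompact.image hcont).measurableSet).2
      ((hconc l hl).mono fun x hx => Set.mem_image_of_mem _ hx)
  refine measure_eq_of_map_projLE_eq ⟨N - 1, by omega⟩
    (fun i => Fin.le_def.2 (Nat.le_sub_one_of_lt i.2))
    (hlam'.1.map_projLE_eq hlam.1 (fun j hj h => ?_) _)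
  -- Extremality for `lam` alone suffices: by the induction hypothesis `h`, both plans have the same
  -- image under `projLT j`.
  refine (hext lam hlam j hj).measure_eq (hP j hj)
    (Φ := fun w => ∑ i : Set.Iio j, φ i (w i)) (ψ := φ j) (hφ.1 j).measurable ?_
    (by rw [fst_map_projLE, h]) (fst_map_projLE j lam)
    (by rw [snd_map_projLE, hlam'.1.2]) (by rw [snd_map_projLE, hlam.1.2])
    (hmem j lam' hlam') (hmem j lam hlam)
  rintro _ ⟨x, hx, rfl⟩
  exact reducedCost_of_mem_minimizingSet hφ.2.1.2 j hx
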